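/- Let $\mathbb{F}_q$ be a finite field with $q$ elements, let $n\ge 0$, and let $J\subseteq\{(i,j) : 1\le i<j\le n\}$ be closed, i.e. $(i,j),(j,k)\in J$ implies $(i,k)\in J$. Let $\mathfrak{n}_J$ be the algebra of $n\times n$ matrices over $\mathbb{F}_q$ whose entries outside the positions in $J$ are $0$, and let $U_J=1+\mathfrak{n}_J$ be the corresponding pattern group. A $4$-chain $(i,j,k,l)\in\mathcal{P}_J$ is a quadruple with $(i,j),(j,k),(k,l)\in J$. Let $J^*$ be the set of functions $J\to\mathbb{F}_q$, and put $\mathrm{supp}(\phi)=\{\alpha\in J : \phi_\alpha\neq 0\}$ for $\phi\in J^*$. For $\phi\in J^*$ let $X_\phi\in\mathfrak{n}_J$ be the matrix with entries $\phi_{ij}$ at $(i,j)\in J$ and $0$ elsewhere, let $x_\phi=1+X_\phi\in U_J$, and let the two-sided orbit (superclass) of $x_\phi$ be $\{1+uX_\phi v : u,v\in U_J\}\subseteq U_J$. For $\eta\in J^*$ let $\lambda_\eta\in\mathfrak{n}_J^*$ be the linear functional $\lambda_\eta(X)=\sum_{(i,j)\in J}\eta_{ij}X_{ij}$. The group $U_J$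 acts on $\mathfrak{n}_J^*$ from both sides by $(u\mu v)(X)=\mu(u^{-1}Xv^{-1})$. Fix a nontrivial homomorphism $\theta:\mathbb{F}_q^+\to\mathbb{C}^\times$. The supercharacter $\chi^\eta:U_J\to\mathbb{C}$ is $$\chi^\eta(u)=\frac{|\lambda_\eta U_J|}{|U_J\lambda_\eta U_J|}\sum_{\mu\in U_J\lambda_\eta U_J}\theta\bigl(\mu(u-1)\bigr).$$ **Proposition.** (a) Let $\phi\in J^*$, and suppose that there is no $4$-chain $(i,j,k,l)\in\mathcal{P}_J$ such that $(i,j),(k,l)\in\mathrm{supp}(\phi)$. Then the two-sided orbit (superclass) of $x_\phi$ is a conjugacy class of $U_J$, namely that of $x_\phi$. (b) Let $\eta\in J^*$, and suppose that there is no $4$-chain $(i,j,k,l)\in\mathcal{P}_J$ such that $(i,k),(j,l)\in\mathrm{supp}(\eta)$. Then $\chi^\eta$ is an irreducible character of $U_J$, i.e. the character of an irreducible finite-dimensional complex representation of $U_J$. -/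

import Mathlib

namespace PatternGroups

/-- A closed set `J` of pairs `(i, j)` with `i < j` (equivalently, a closed set of positive roots
of type `A`): if `(i, j)` and `(j, k)` are in `J`, then so is `(i, k)`. -/
structure ClosedPattern (n : ℕ) where
  pairs : Finset (Fin n × Fin n)
  lt_of_mem : ∀ {i j : Fin n}, (i, j) ∈ pairs → i < j
  closed : ∀ {i j k : Fin n}, (i, j) ∈ pairs → (j, k) ∈ pairs → (i, k) ∈ pairs

variable {n : ℕ}

/-- `(i, j, k, l)` is a 4-chain of the poset given by `J`. -/
def ClosedPattern.IsFourChain (J : ClosedPattern n) (i j k l : Fin n) : Prop :=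
  (i, j) ∈ J.pairs ∧ (j, k) ∈ J.pairs ∧ (k, l) ∈ J.pairs

/-- The set `J^*` of functions `J → F`. -/
abbrev Labelling (J : ClosedPattern n) (F : Type*) : Type _ := J.pairs → F

/-- The support of `φ ∈ J^*`, as a set of pairs. -/
def supp {J : ClosedPattern n} {F : Type*} [Zero F] (φ : Labelling J F) : Set (Fin n × Fin n) :=
  {p | ∃ h : p ∈ J.pairs, φ ⟨p, h⟩ ≠ 0}

/-- The nilpotent algebra `𝔫_J` of matrices that vanish outside `J`, as a vector space. -/
def nilAlgebra (J : ClosedPattern n) (F : Type*) [Field F] :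
    Submodule F (Matrix (Fin n) (Fin n) F) where
  carrier := {X | ∀ i j, (i, j) ∉ J.pairs → X i j = 0}
  add_mem' {X Y} hX hY i j h := by simp [hX i j h, hY i j h]
  zero_mem' i j _ := rfl
  smul_mem' c X hX i j h := by simp [hX i j h]

theorem mul_mem_nilAlgebra {J : ClosedPattern n} {F : Type*} [Field F]
    {X Y : Matrix (Fin n) (Fin n) F} (hX : X ∈ nilAlgebra J F) (hY : Y ∈ nilAlgebra J F) :
    X * Y ∈ nilAlgebra J F := by
  intro i k h
  rw [Matrix.mul_apply]
  refine Finset.sum_eq_zero fun j _ => ?_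
  by_cases h1 : (i, j) ∈ J.pairs
  · by_cases h2 : (j, k) ∈ J.pairs
    · exact absurd (J.closed h1 h2) h
    · simp [hY j k h2]
  · simp [hX i j h1]

/-- The pattern group `U_J = 1 + 𝔫_J`: the invertible matrices `u` (unipotent and upper triangular)
such that `u - 1` vanishes outside `J`. -/
def patternGroup (J : ClosedPattern n) (F : Type*) [Field F] [Finite F] :
    Subgroup (GL (Fin n) F) :=
  let S : Submonoid (GL (Fin n) F) :=
    { carrier := {u | (u : Matrix (Fin n) (Fin n) F) - 1 ∈ nilAlgebra J F}
      one_mem' := by simp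
      mul_mem' := by
        intro u v hu hv
        have h : ((u * v : GL (Fin n) F) : Matrix (Fin n) (Fin n) F) - 1 =
            ((u : Matrix (Fin n) (Fin n) F) - 1) * ((v : Matrix (Fin n) (Fin n) F) - 1) +
              (((u : Matrix (Fin n) (Fin n) F) - 1) + ((v : Matrix (Fin n) (Fin n) F) - 1)) := by
          push_cast
          noncomm_ring
        change ((u * v : GL (Fin n) F) : Matrix (Fin n) (Fin n) F) - 1 ∈ nilAlgebra J F
        rw [h]
        exact add_mem (mul_mem_nilAlgebra hu hv) (add_mem hu hv) }
  { S with
    inv_mem' := by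
      intro u hu
      have h : u⁻¹ ∈ Submonoid.powers u := by
        have h1 : u⁻¹ ∈ (Subgroup.zpowers u : Set (GL (Fin n) F)) :=
          inv_mem (Subgroup.mem_zpowers u)
        rw [← powers_eq_zpowers] at h1
        exact h1
      exact (Submonoid.powers_le (P := S)).2 hu h }

section

variable {J : ClosedPattern n} {F : Type*} [Field F]

/-- The matrix `X_φ ∈ 𝔫_J` with entries `φ_{ij}` at the places `(i, j) ∈ J` and zeros elsewhere. -/
def nilElement (φ : Labelling J F) : nilAlgebra J F :=
  ⟨Matrix.of fun i j => if h : (i, j) ∈ J.pairs then φ ⟨(i, j), h⟩ else 0,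
    fun i j h => by simp [h]⟩

/-- The functional `λ_η = ∑_{α ∈ J} η_α λ_α` on `𝔫_J`, where `λ_α` reads off the entry at `α`. -/
def functional (η : Labelling J F) : Module.Dual F (nilAlgebra J F) where
  toFun X := ∑ α : J.pairs, η α * (X : Matrix (Fin n) (Fin n) F) α.1.1 α.1.2
  map_add' X Y := by simp [mul_add, Finset.sum_add_distrib]
  map_smul' c X := by simp [Finset.mul_sum, mul_left_comm]

theorem det_one_add (X : nilAlgebra J F) :
    (1 + (X : Matrix (Fin n) (Fin n) F)).det = 1 := by
  have hX : ∀ i j : Fin n, j ≤ i → (X : Matrix (Fin n) (Fin n) F) i j = 0 :=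
    fun i j hij => X.2 i j fun h => absurd (J.lt_of_mem h) (not_lt.2 hij)
  rw [Matrix.det_of_isUpperTriangular]
  · simp [hX _ _ le_rfl]
  · intro i j hij
    have hij' : j < i := hij
    simp [hX i j hij'.le, Matrix.one_apply_ne hij'.ne']

variable [Finite F]

/-- The element `1 + X` of `U_J`, for `X ∈ 𝔫_J`. -/
noncomputable def oneAdd (X : nilAlgebra J F) : patternGroup J F :=
  ⟨Matrix.GeneralLinearGroup.mkOfDetNeZero (1 + (X : Matrix (Fin n) (Fin n) F))
      (by rw [det_one_add]; exact one_ne_zero), by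
    change (1 + (X : Matrix (Fin n) (Fin n) F)) - 1 ∈ nilAlgebra J F
    rw [add_sub_cancel_left]
    exact X.2⟩

/-- The element `x_φ = 1 + X_φ` of `U_J`. -/
noncomputable def groupElement (φ : Labelling J F) : patternGroup J F :=
  oneAdd (nilElement φ)

/-- The element `u - 1` of `𝔫_J`, for `u ∈ U_J`. -/
def subOne (u : patternGroup J F) : nilAlgebra J F :=
  ⟨((u : GL (Fin n) F) : Matrix (Fin n) (Fin n) F) - 1, u.2⟩

/-- The linear map `X ↦ u X v` of `𝔫_J`, for `u, v ∈ U_J`. -/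
def twoSidedMul (u v : patternGroup J F) : nilAlgebra J F →ₗ[F] nilAlgebra J F where
  toFun X :=
    ⟨((u : GL (Fin n) F) : Matrix (Fin n) (Fin n) F) * X *
        ((v : GL (Fin n) F) : Matrix (Fin n) (Fin n) F), by
      have hl : ∀ Y ∈ nilAlgebra J F,
          ((u : GL (Fin n) F) : Matrix (Fin n) (Fin n) F) * Y ∈ nilAlgebra J F := by
        intro Y hY
        have h := add_mem (mul_mem_nilAlgebra (subOne u).2 hY) hY
        simpa [subOne, sub_mul] using h
      have hr : ∀ Y ∈ nilAlgebra J F,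
          Y * ((v : GL (Fin n) F) : Matrix (Fin n) (Fin n) F) ∈ nilAlgebra J F := by
        intro Y hY
        have h := add_mem (mul_mem_nilAlgebra hY (subOne v).2) hY
        simpa [subOne, mul_sub] using h
      exact hr _ (hl _ X.2)⟩
  map_add' X Y := by
    apply Subtype.ext
    simp [mul_add, add_mul]
  map_smul' c X := by
    apply Subtype.ext
    simp

/-- The orbit `O_φ` of `X_φ` under left and right multiplication by `U_J`. -/
def twoSidedOrbit (φ : Labelling J F) : Set (nilAlgebra J F) :=
  {Y | ∃ u v : patternGroup J F, Y = twoSidedMul u v (nilElement φ)}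

/-- The superclass `1 + O_φ = {x_ρ | ρ ∈ O_φ}` of `x_φ` in `U_J`. -/
def superclass (φ : Labelling J F) : Set (patternGroup J F) :=
  {g | subOne g ∈ twoSidedOrbit φ}

/-- The action of `U_J` on `𝔫_J^*` from both sides: `(u μ v)(X) = μ(u⁻¹ X v⁻¹)`. -/
def coMul (u : patternGroup J F) (μ : Module.Dual F (nilAlgebra J F)) (v : patternGroup J F) :
    Module.Dual F (nilAlgebra J F) :=
  μ ∘ₗ twoSidedMul u⁻¹ v⁻¹

/-- The two-sided orbit `O^η = U_J λ_η U_J` in `𝔫_J^*`. -/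
def twoSidedCoorbit (η : Labelling J F) : Set (Module.Dual F (nilAlgebra J F)) :=
  Set.range fun p : patternGroup J F × patternGroup J F => coMul p.1 (functional η) p.2

/-- The right orbit `λ_η U_J` in `𝔫_J^*`. -/
def rightCoorbit (η : Labelling J F) : Set (Module.Dual F (nilAlgebra J F)) :=
  Set.range fun v : patternGroup J F => coMul 1 (functional η) v

theorem finite_twoSidedCoorbit (η : Labelling J F) : (twoSidedCoorbit η).Finite := by
  have : Finite (GL (Fin n) F) := inferInstance
  exact Set.finite_range _

/-- The supercharacter `χ^η = (|λ_η U_J| / |U_J λ_η U_J|) ∑_{μ ∈ U_J λ_η U_J} θ ∘ μ`, where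
`(θ ∘ μ)(u)` means `θ(μ(u - 1))` for `u ∈ U_J`. -/
noncomputable def supercharacter (θ : AddChar F ℂ) (η : Labelling J F) (u : patternGroup J F) :
    ℂ :=
  ((rightCoorbit η).ncard : ℂ) / ((twoSidedCoorbit η).ncard : ℂ) *
    ∑ μ ∈ (finite_twoSidedCoorbit η).toFinset, θ (μ (subOne u))

end

/-- `χ` is the character of an irreducible finite-dimensional complex representation of `G`. -/
def IsIrreducibleCharacter {G : Type*} [Group G] (χ : G → ℂ) : Prop :=
  ∃ (V : Type) (_ : AddCommGroup V) (_ : Module ℂ V) (_ : FiniteDimensional ℂ V)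
    (ρ : Representation ℂ G V), ρ.IsIrreducible ∧ ρ.character = χ

end PatternGroups

/-! (a) Write X for X_φ. Sorting the rows of a nilpotent matrix by whether they meet a column of
supp φ, the chain hypothesis factors every element of U_J as d c with X d = X and c X = X
(`exists_eq_mul_of_annihilators`). If v u = d c, then u X v = u X c u⁻¹ = (u c⁻¹) X (u c⁻¹)⁻¹, so
two-sided translates are conjugates.

(b) Write λ for λ_η. Summing over left translations first identifies χ^η with the character of a
monomial representation on functions on the orbit λU_J (`supercharacter_eq`). By Mackey's criterion
it is irreducible once the linear characters attached to λ and to any other orbit point μ differ on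
the intersection of the two stabilizers. Let μ(X) = λ(X(1 + A)), and suppose that they agree there.
Linear duality then yields C with λ(BA) = λ(CB) for all B. The chain hypothesis says that each
matrix unit e satisfies λ(eA') = 0 for all A' or λ(A'e) = 0 for all A'. So both sides vanish on all
matrix units, and μ = λ. -/

namespace PatternGroups

/-! ### Monomial representations and Mackey's criterion -/

section Monomial

variable {G O : Type*} [Group G] [MulAction G O]

/-- The monomial representation on functions `O → ℂ` attached to a cocycle `c`. -/
def monomialRep (c : G → O → ℂ) (hone : ∀ x, c 1 x = 1)
    (hmul : ∀ g h x, c (g * h) x = c g x * c h (g⁻¹ • x)) : Representation ℂ G (O → ℂ) where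
  toFun g :=
    { toFun := fun f x => c g x * f (g⁻¹ • x)
      map_add' := fun f f' => by funext x; simp [mul_add]
      map_smul' := fun a f => by funext x; simp [mul_left_comm] }
  map_one' := by
    ext f x
    simp [hone]
  map_mul' g h := by
    apply LinearMap.ext
    intro f
    funext x
    simp [hmul, mul_smul, mul_assoc]

variable (c : G → O → ℂ) (hone : ∀ x, c 1 x = 1)
    (hmul : ∀ g h x, c (g * h) x = c g x * c h (g⁻¹ • x))

@[simp]
theorem monomialRep_apply (g : G) (f : O → ℂ) (x : O) :
    monomialRep c hone hmul g f x = c g x * f (g⁻¹ • x) := rfl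

theorem cocycle_ne_zero (hone : ∀ x, c 1 x = 1)
    (hmul : ∀ g h x, c (g * h) x = c g x * c h (g⁻¹ • x)) (g : G) (x : O) : c g x ≠ 0 := by
  intro h
  have := hmul g g⁻¹ x
  simp [hone, h] at this

theorem character_monomialRep [Fintype O] [DecidableEq O] (g : G) :
    (monomialRep c hone hmul).character g = ∑ x, if g⁻¹ • x = x then c g x else 0 := by
  rw [Representation.character, LinearMap.trace_eq_matrix_trace ℂ (Pi.basisFun ℂ O), Matrix.trace]
  refine Finset.sum_congr rfl fun x _ => ?_
  simp [Pi.single_apply]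

/-- Mackey's criterion for a transitive monomial representation. -/
theorem isIrreducible_monomialRep [Finite G] [Finite O] [MulAction.IsPretransitive G O] (o : O)
    (hsep : ∀ x, x ≠ o → ∃ s : G, s • o = o ∧ s • x = x ∧ c s o ≠ c s x) :
    (monomialRep c hone hmul).IsIrreducible := by
  classical
  have := Fintype.ofFinite G
  have := Fintype.ofFinite O
  have hne := cocycle_ne_zero c hone hmul
  have key : ∀ W : Subrepresentation (monomialRep c hone hmul), W = ⊥ ∨ W = ⊤ := by
    intro W
    by_cases hW : W.toSubmodule = ⊥
    · left
      exact Subrepresentation.toSubmodule_injective hW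
    right
    obtain ⟨f₀, hf₀, hf₀'⟩ := Submodule.exists_mem_ne_zero_of_ne_bot hW
    obtain ⟨y, hy⟩ := Function.ne_iff.1 hf₀'
    obtain ⟨g, hg⟩ := MulAction.exists_smul_eq G y o
    obtain ⟨f, hf, hfo⟩ : ∃ f ∈ W.toSubmodule, f o ≠ 0 := by
      refine ⟨_, W.apply_mem_toSubmodule g hf₀, ?_⟩
      rw [monomialRep_apply, ← hg, inv_smul_smul]
      exact mul_ne_zero (hne _ _) hy
    -- Averaging over the stabilizer of `o`, twisted by its linear character, projects onto the line
    -- of functions supported at `o`.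
    have hE : ∑ s : MulAction.stabilizer G o, (c s o)⁻¹ • monomialRep c hone hmul s f =
        Pi.single o (Fintype.card (MulAction.stabilizer G o) * f o) := by
      funext x
      simp only [Finset.sum_apply, Pi.smul_apply, monomialRep_apply, smul_eq_mul]
      by_cases hx : x = o
      · subst hx
        rw [Pi.single_eq_same]
        have : ∀ s : MulAction.stabilizer G x, (c s x)⁻¹ * (c s x * f ((s : G)⁻¹ • x)) = f x := by
          intro s
          rw [inv_smul_eq_iff.2 s.2.symm, inv_mul_cancel_left₀ (hne _ _)]
        simp [this]
      · rw [Pi.single_eq_of_ne hx]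
        obtain ⟨s, hso, hsx, hs⟩ := hsep x hx
        set T := ∑ s : MulAction.stabilizer G o, (c s o)⁻¹ * (c s x * f ((s : G)⁻¹ • x)) with hT
        -- Since `s` fixes `o` and `x`, replacing t by s t multiplies the sum by a ratio different
        -- from 1, so the sum is zero.
        have hTT : T = (c s o)⁻¹ * c s x * T := by
          conv_lhs => rw [hT]
          rw [← Equiv.sum_comp (Equiv.mulLeft (⟨s, hso⟩ : MulAction.stabilizer G o)), hT,
            Finset.mul_sum]
          refine Finset.sum_congr rfl fun t _ => ?_
          simp only [Equiv.coe_mulLeft, Subgroup.coe_mul, hmul, mul_inv_rev, mul_smul,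
            inv_smul_eq_iff.2 hso.symm, inv_smul_eq_iff.2 hsx.symm]
          ring
        by_contra hT0
        have h1 : (c s o)⁻¹ * c s x = 1 := by
          have := mul_right_cancel₀ hT0 ((one_mul T).trans hTT)
          exact this.symm
        exact hs ((inv_mul_eq_one₀ (hne _ _)).1 h1)
    have hsingle : ∀ a : ℂ, Pi.single o a ∈ W.toSubmodule := by
      intro a
      have h1 : Pi.single o (Fintype.card (MulAction.stabilizer G o) * f o) ∈ W.toSubmodule := by
        rw [← hE]
        exact sum_mem fun s _ => W.toSubmodule.smul_mem _ (W.apply_mem_toSubmodule _ hf)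
      have h2 : (Fintype.card (MulAction.stabilizer G o) * f o : ℂ) ≠ 0 :=
        mul_ne_zero (Nat.cast_ne_zero.2 Fintype.card_ne_zero) hfo
      have h3 := W.toSubmodule.smul_mem
        (a * (Fintype.card (MulAction.stabilizer G o) * f o : ℂ)⁻¹) h1
      rwa [← Pi.single_smul, smul_eq_mul, inv_mul_cancel_right₀ h2] at h3
    have hall : ∀ (x : O) (a : ℂ), Pi.single x a ∈ W.toSubmodule := by
      intro x a
      obtain ⟨g, rfl⟩ := MulAction.exists_smul_eq G o x
      have h1 := W.apply_mem_toSubmodule g (hsingle ((c g (g • o))⁻¹ * a))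
      convert h1 using 1
      funext y
      rw [monomialRep_apply]
      by_cases hy : y = g • o
      · subst hy
        simp [mul_inv_cancel_left₀ (hne _ _)]
      · rw [Pi.single_eq_of_ne hy, Pi.single_eq_of_ne, mul_zero]
        rwa [Ne, inv_smul_eq_iff]
    apply Subrepresentation.toSubmodule_injective
    refine (eq_top_iff.2 fun f _ => ?_ : W.toSubmodule = ⊤)
    rw [← Finset.univ_sum_single f]
    exact sum_mem fun x _ => hall _ _
  have : Nontrivial (Subrepresentation (monomialRep c hone hmul)) := by
    refine ⟨⊥, ⊤, fun h => ?_⟩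
    have h' : (⊥ : Submodule ℂ (O → ℂ)) = ⊤ := congrArg Subrepresentation.toSubmodule h
    have : Nonempty O := ⟨o⟩
    exact bot_ne_top h'
  exact ⟨key⟩

theorem isIrreducibleCharacter_of_type_zero {O : Type} [MulAction G O]
    (c : G → O → ℂ) (hone : ∀ x, c 1 x = 1)
    (hmul : ∀ g h x, c (g * h) x = c g x * c h (g⁻¹ • x))
    [Finite G] [Fintype O] [DecidableEq O] [MulAction.IsPretransitive G O] (o : O)
    (hsep : ∀ x, x ≠ o → ∃ s : G, s • o = o ∧ s • x = x ∧ c s o ≠ c s x) :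
    IsIrreducibleCharacter fun g : G => ∑ x : O, if g⁻¹ • x = x then c g x else 0 :=
  ⟨O → ℂ, inferInstance, inferInstance, inferInstance, monomialRep c hone hmul,
    isIrreducible_monomialRep c hone hmul o hsep,
    funext fun g => character_monomialRep c hone hmul g⟩

theorem isIrreducibleCharacter_monomial (hone : ∀ x, c 1 x = 1)
    (hmul : ∀ g h x, c (g * h) x = c g x * c h (g⁻¹ • x)) [Finite G] [Fintype O] [DecidableEq O]
    [MulAction.IsPretransitive G O] (o : O)
    (hsep : ∀ x, x ≠ o → ∃ s : G, s • o = o ∧ s • x = x ∧ c s o ≠ c s x) :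
    IsIrreducibleCharacter fun g : G => ∑ x : O, if g⁻¹ • x = x then c g x else 0 := by
  -- `IsIrreducibleCharacter` asks for a space in `Type`, while `O` may live in a higher universe;
  -- the action is moved to `Fin`.
  let e : Fin (Fintype.card O) ≃ O := (Fintype.equivFin O).symm
  let _ : MulAction G (Fin (Fintype.card O)) := e.mulAction G
  have he : ∀ (g : G) x, e (g • x) = g • e x := fun g x => by
    rw [Equiv.smul_def, Equiv.apply_symm_apply]
  have : MulAction.IsPretransitive G (Fin (Fintype.card O)) := ⟨fun x y => by
    obtain ⟨g, hg⟩ := MulAction.exists_smul_eq G (e x) (e y)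
    exact ⟨g, e.injective ((he g x).trans hg)⟩⟩
  have h := isIrreducibleCharacter_of_type_zero (G := G) (O := Fin (Fintype.card O))
    (fun g x => c g (e x)) (fun x => hone _) (fun g h x => by rw [hmul, he]) (e.symm o)
    (fun x hx => by
      obtain ⟨s, h1, h2, h3⟩ := hsep (e x) fun h => hx (by simp [← h])
      refine ⟨s, e.injective ?_, e.injective ?_, ?_⟩
      · rw [he, e.apply_symm_apply, h1]
      · rw [he, h2]
      · rwa [e.apply_symm_apply])
  convert h using 1
  funext g
  rw [← Equiv.sum_comp e]
  simp only [← he, e.injective.eq_iff]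

end Monomial

/-- By `hp`, left translations permute the fibres of `p` transitively, so all fibres have the same
size. This converts sums over orbits into sums over the group. -/
theorem card_mul_sum_comp {H Y : Type*} [Group H] [Fintype H] [DecidableEq Y] (p : H → Y)
    (hp : ∀ a b c, p a = p b → p (c * a) = p (c * b)) (s : Finset Y)
    (hs : (s : Set Y) = Set.range p) (f : Y → ℂ) :
    (s.card : ℂ) * ∑ h, f (p h) = Fintype.card H * ∑ y ∈ s, f y := by
  have hmaps : ∀ h ∈ (Finset.univ : Finset H), p h ∈ s := fun h _ => by
    rw [← Finset.mem_coe, hs]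
    exact ⟨h, rfl⟩
  have hfib : ∀ y ∈ s, (Finset.univ.filter fun h => p h = y).card =
      (Finset.univ.filter fun h => p h = p 1).card := by
    intro y hy
    rw [← Finset.mem_coe, hs] at hy
    obtain ⟨a, rfl⟩ := hy
    refine Finset.card_bij' (fun h _ => a⁻¹ * h) (fun h _ => a * h) ?_ ?_ ?_ ?_
    · intro h hh
      have := hp h a a⁻¹ (by simpa using hh)
      simpa using this
    · intro h hh
      have := hp h 1 a (by simpa using hh)
      simpa using this
    · simp
    · simp
  have hcard : Fintype.card H = s.card * (Finset.univ.filter fun h => p h = p 1).card := by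
    rw [← Finset.card_univ, Finset.card_eq_sum_card_fiberwise hmaps, Finset.sum_congr rfl hfib]
    simp
  rw [← Finset.sum_fiberwise_of_maps_to hmaps]
  have : ∀ y ∈ s, ∑ h with p h = y, f (p h) =
      (Finset.univ.filter fun h => p h = p 1).card * f y := by
    intro y hy
    rw [← hfib y hy, Finset.sum_congr rfl fun h hh => by rw [(Finset.mem_filter.1 hh).2]]
    simp
  rw [Finset.sum_congr rfl this, ← Finset.mul_sum, hcard]
  push_cast
  ring

/-! ### Superclasses as conjugacy classes, and the two-sided actions -/

section

variable {n : ℕ} {J : ClosedPattern n} {F : Type*} [Field F]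

theorem nilElement_apply_ne_zero {φ : Labelling J F} {i j : Fin n}
    (h : (nilElement φ : Matrix (Fin n) (Fin n) F) i j ≠ 0) : (i, j) ∈ supp φ := by
  by_cases hij : (i, j) ∈ J.pairs
  · refine ⟨hij, ?_⟩
    simpa [nilElement, hij] using h
  · exact absurd ((nilElement φ).2 i j hij) h

/-- `D` drops the rows of `B` indexed by columns that meet supp φ, and `C` consists of the dropped
rows. A nonzero term of C X_φ would give (i, j), (k, l) in the support with (j, k) in `J`, a
forbidden chain. -/
theorem exists_add_annihilators (φ : Labelling J F)
    (hφ : ¬ ∃ i j k l : Fin n, J.IsFourChain i j k l ∧ (i, j) ∈ supp φ ∧ (k, l) ∈ supp φ)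
    (B : nilAlgebra J F) : ∃ D C : nilAlgebra J F, B = D + C ∧
      (nilElement φ : Matrix (Fin n) (Fin n) F) * (D : Matrix (Fin n) (Fin n) F) = 0 ∧
      (C : Matrix (Fin n) (Fin n) F) * (nilElement φ : Matrix (Fin n) (Fin n) F) = 0 := by
  classical
  let D : nilAlgebra J F := ⟨Matrix.of fun j k => if ∃ i, (i, j) ∈ supp φ then 0 else B.1 j k,
    fun j k h => by simp [B.2 j k h]⟩
  refine ⟨D, B - D, (add_sub_cancel _ _).symm, ?_, ?_⟩
  · ext i k
    rw [Matrix.mul_apply, Matrix.zero_apply]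
    refine Finset.sum_eq_zero fun j _ => ?_
    by_contra h
    obtain ⟨h1, h2⟩ := mul_ne_zero_iff.1 h
    exact h2 (if_pos ⟨i, nilElement_apply_ne_zero h1⟩)
  · ext j l
    rw [Matrix.mul_apply, Matrix.zero_apply]
    refine Finset.sum_eq_zero fun k _ => ?_
    by_contra h
    obtain ⟨h1, h2⟩ := mul_ne_zero_iff.1 h
    have hjk : (j, k) ∈ J.pairs := by
      by_contra hjk
      exact h1 ((B - D).2 j k hjk)
    have hkl := nilElement_apply_ne_zero h2
    by_cases hi : ∃ i, (i, j) ∈ supp φ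
    · obtain ⟨i, hi⟩ := hi
      exact hφ ⟨i, j, k, l, ⟨hi.1, hjk, hkl.1⟩, hi, hkl⟩
    · exact h1 (by simp [D, if_neg hi])

variable [Finite F]

/-- The matrix of an element of the pattern group. -/
abbrev toMatrix (u : patternGroup J F) : Matrix (Fin n) (Fin n) F :=
  ((u : GL (Fin n) F) : Matrix (Fin n) (Fin n) F)

theorem toMatrix_mul (u v : patternGroup J F) :
    toMatrix (u * v) = toMatrix u * toMatrix v := rfl

theorem toMatrix_one : toMatrix (1 : patternGroup J F) = 1 := by simp

theorem toMatrix_mul_inv (u : patternGroup J F) : toMatrix u * toMatrix u⁻¹ = 1 := by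
  rw [← toMatrix_mul, mul_inv_cancel, toMatrix_one]

theorem toMatrix_inv_mul (u : patternGroup J F) : toMatrix u⁻¹ * toMatrix u = 1 := by
  rw [← toMatrix_mul, inv_mul_cancel, toMatrix_one]

theorem toMatrix_injective : Function.Injective (toMatrix : patternGroup J F → _) :=
  fun _ _ h => Subtype.ext (Units.ext h)

theorem toMatrix_oneAdd (X : nilAlgebra J F) :
    toMatrix (oneAdd X) = 1 + (X : Matrix (Fin n) (Fin n) F) := rfl

theorem coe_subOne (u : patternGroup J F) :
    (subOne u : Matrix (Fin n) (Fin n) F) = toMatrix u - 1 := rfl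

theorem oneAdd_subOne (u : patternGroup J F) : oneAdd (subOne u) = u :=
  toMatrix_injective (by rw [toMatrix_oneAdd, coe_subOne, add_sub_cancel])

theorem subOne_oneAdd (X : nilAlgebra J F) : subOne (oneAdd X) = X :=
  Subtype.ext (by rw [coe_subOne, toMatrix_oneAdd, add_sub_cancel_left])

theorem coe_twoSidedMul (u v : patternGroup J F) (X : nilAlgebra J F) :
    (twoSidedMul u v X : Matrix (Fin n) (Fin n) F) =
      toMatrix u * (X : Matrix (Fin n) (Fin n) F) * toMatrix v := rfl

/-- With d = 1 + D and v = d + C one gets c = d⁻¹v = 1 + d⁻¹C, which fixes X_φ from the left because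
C X_φ = 0. -/
theorem exists_eq_mul_of_annihilators (φ : Labelling J F)
    (hφ : ¬ ∃ i j k l : Fin n, J.IsFourChain i j k l ∧ (i, j) ∈ supp φ ∧ (k, l) ∈ supp φ)
    (v : patternGroup J F) : ∃ d c : patternGroup J F, v = d * c ∧
      (nilElement φ : Matrix (Fin n) (Fin n) F) * toMatrix d = nilElement φ ∧
      toMatrix c * (nilElement φ : Matrix (Fin n) (Fin n) F) = nilElement φ := by
  obtain ⟨D, C, h, hD, hC⟩ := exists_add_annihilators φ hφ (subOne v)
  refine ⟨oneAdd D, (oneAdd D)⁻¹ * v, (mul_inv_cancel_left _ _).symm, ?_, ?_⟩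
  · rw [toMatrix_oneAdd, mul_add, hD, mul_one, add_zero]
  · have hv : toMatrix v = toMatrix (oneAdd D) + (C : Matrix (Fin n) (Fin n) F) := by
      rw [← oneAdd_subOne v, h, toMatrix_oneAdd, toMatrix_oneAdd, Submodule.coe_add, add_assoc]
    rw [toMatrix_mul, mul_assoc, hv, add_mul, hC, add_zero, ← mul_assoc, toMatrix_inv_mul, one_mul]

theorem superclass_eq_conjugatesOf (φ : Labelling J F)
    (hφ : ¬ ∃ i j k l : Fin n, J.IsFourChain i j k l ∧ (i, j) ∈ supp φ ∧ (k, l) ∈ supp φ) :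
    superclass φ = conjugatesOf (groupElement φ) := by
  have hconj : ∀ w : patternGroup J F, toMatrix (w * groupElement φ * w⁻¹) =
      1 + toMatrix w * (nilElement φ : Matrix (Fin n) (Fin n) F) * toMatrix w⁻¹ := by
    intro w
    rw [groupElement, toMatrix_mul, toMatrix_mul, toMatrix_oneAdd, mul_add, mul_one, add_mul,
      toMatrix_mul_inv]
  ext g
  rw [conjugatesOf, Set.mem_ofPred_eq, isConj_iff]
  constructor
  · rintro ⟨u, v, h⟩
    obtain ⟨d, c, hdc, hd, hc⟩ := exists_eq_mul_of_annihilators φ hφ (v * u)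
    have hv : v = d * c * u⁻¹ := by rw [← hdc, mul_inv_cancel_right]
    have hc' : toMatrix c⁻¹ * (nilElement φ : Matrix (Fin n) (Fin n) F) = nilElement φ := by
      conv_lhs => rw [← hc]
      rw [← mul_assoc, toMatrix_inv_mul, one_mul]
    refine ⟨u * c⁻¹, toMatrix_injective ?_⟩
    have hg : toMatrix g = 1 + (subOne g : Matrix (Fin n) (Fin n) F) := by
      rw [coe_subOne, add_sub_cancel]
    rw [hconj, hg, h, coe_twoSidedMul, hv, mul_inv_rev, inv_inv]
    simp only [toMatrix_mul]
    rw [mul_assoc (toMatrix u), hc', mul_assoc, mul_assoc, mul_assoc (toMatrix d),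
      ← mul_assoc _ (toMatrix d), hd]
  · rintro ⟨w, rfl⟩
    refine ⟨w, w⁻¹, Subtype.ext ?_⟩
    rw [coe_subOne, hconj, add_sub_cancel_left, coe_twoSidedMul]

theorem twoSidedMul_twoSidedMul (u v u' v' : patternGroup J F) (X : nilAlgebra J F) :
    twoSidedMul u v (twoSidedMul u' v' X) = twoSidedMul (u * u') (v' * v) X :=
  Subtype.ext (by simp only [coe_twoSidedMul, toMatrix_mul, mul_assoc])

theorem twoSidedMul_one_one (X : nilAlgebra J F) : twoSidedMul 1 1 X = X :=
  Subtype.ext (by rw [coe_twoSidedMul, toMatrix_one, one_mul, mul_one])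

theorem coMul_apply (u v : patternGroup J F) (μ : Module.Dual F (nilAlgebra J F))
    (X : nilAlgebra J F) : coMul u μ v X = μ (twoSidedMul u⁻¹ v⁻¹ X) := rfl

theorem coMul_coMul (u v u' v' : patternGroup J F) (μ : Module.Dual F (nilAlgebra J F)) :
    coMul u (coMul u' μ v') v = coMul (u * u') μ (v' * v) :=
  LinearMap.ext fun X => by
    simp only [coMul_apply, twoSidedMul_twoSidedMul, mul_inv_rev]

theorem coMul_one_one (μ : Module.Dual F (nilAlgebra J F)) : coMul 1 μ 1 = μ :=
  LinearMap.ext fun X => by simp only [coMul_apply, inv_one, twoSidedMul_one_one]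

end

/-! ### Left and right translates of the functional -/

section

variable {n : ℕ} {J : ClosedPattern n} {F : Type*} [Field F]

/-- The product of two elements of the nilpotent algebra, as a bilinear map. -/
def nilMul : nilAlgebra J F →ₗ[F] nilAlgebra J F →ₗ[F] nilAlgebra J F :=
  LinearMap.mk₂ F (fun X Y => ⟨X.1 * Y.1, mul_mem_nilAlgebra X.2 Y.2⟩)
    (fun _ _ _ => Subtype.ext (add_mul _ _ _)) (fun _ _ _ => Subtype.ext (smul_mul_assoc _ _ _))
    (fun _ _ _ => Subtype.ext (mul_add _ _ _)) (fun _ _ _ => Subtype.ext (mul_smul_comm _ _ _))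

theorem coe_nilMul (X Y : nilAlgebra J F) : (nilMul X Y : Matrix (Fin n) (Fin n) F) = X.1 * Y.1 :=
  rfl

/-- The matrix unit at a place of `J`. -/
def nilSingle (α : J.pairs) : nilAlgebra J F :=
  ⟨Matrix.single α.1.1 α.1.2 1, fun i j h => by
    rw [Matrix.single_apply, if_neg]
    rintro ⟨rfl, rfl⟩
    exact h α.2⟩

theorem eq_sum_nilSingle (X : nilAlgebra J F) :
    X = ∑ α : J.pairs, X.1 α.1.1 α.1.2 • nilSingle α := by
  apply Subtype.ext
  ext i j
  rw [Submodule.coe_sum, Matrix.sum_apply]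
  simp only [nilSingle, Submodule.coe_smul, Matrix.smul_apply, Matrix.single_apply, smul_eq_mul]
  by_cases h : (i, j) ∈ J.pairs
  · rw [Finset.sum_eq_single ⟨(i, j), h⟩]
    · simp
    · rintro ⟨⟨a, b⟩, hab⟩ _ hne
      rw [if_neg, mul_zero]
      rintro ⟨rfl, rfl⟩
      exact hne rfl
    · simp
  · rw [X.2 i j h, Finset.sum_eq_zero]
    rintro ⟨⟨a, b⟩, hab⟩ _
    rw [if_neg, mul_zero]
    rintro ⟨rfl, rfl⟩
    exact h hab

theorem dual_ext {f g : Module.Dual F (nilAlgebra J F)}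
    (h : ∀ α, f (nilSingle α) = g (nilSingle α)) : f = g :=
  LinearMap.ext fun X => by
    rw [eq_sum_nilSingle X]
    simp only [map_sum, map_smul, h]

/-- If both alternatives fail for the unit at (j, k), nonzero terms of the two sums give (j, l) and
(i, k) in supp η with (k, l), (i, j) in `J`: a forbidden chain. -/
theorem nilSingle_annihilates (η : Labelling J F)
    (hη : ¬ ∃ i j k l : Fin n, J.IsFourChain i j k l ∧ (i, k) ∈ supp η ∧ (j, l) ∈ supp η)
    (α : J.pairs) : (∀ A, functional η (nilMul (nilSingle α) A) = 0) ∨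
      ∀ A, functional η (nilMul A (nilSingle α)) = 0 := by
  obtain ⟨⟨j, k⟩, hjk⟩ := α
  by_contra! h
  obtain ⟨⟨A, hA⟩, ⟨B, hB⟩⟩ := h
  obtain ⟨⟨⟨a, l⟩, hal⟩, -, h1⟩ := Finset.exists_ne_zero_of_sum_ne_zero hA
  obtain ⟨⟨⟨i, b⟩, hib⟩, -, h2⟩ := Finset.exists_ne_zero_of_sum_ne_zero hB
  simp only [coe_nilMul, nilSingle] at h1 h2
  obtain ⟨h3, h1'⟩ := mul_ne_zero_iff.1 h1
  obtain ⟨h4, h2'⟩ := mul_ne_zero_iff.1 h2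
  have haj : a = j := by
    by_contra hne
    exact h1' (Matrix.single_mul_apply_of_ne _ _ _ _ _ hne _)
  have hbk : b = k := by
    by_contra hne
    exact h2' (Matrix.mul_single_apply_of_ne _ _ _ _ _ hne _)
  subst haj hbk
  rw [Matrix.single_mul_apply_same, one_mul] at h1'
  rw [Matrix.mul_single_apply_same, mul_one] at h2'
  have hkl : (b, l) ∈ J.pairs := by
    by_contra h
    exact h1' (A.2 _ _ h)
  have hij : (i, a) ∈ J.pairs := by
    by_contra h
    exact h2' (B.2 _ _ h)
  exact hη ⟨i, a, b, l, ⟨hij, hjk, hkl⟩, ⟨hib, h4⟩, ⟨hal, h3⟩⟩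

/-- The right and left translates of `λ_η` by the nilpotent algebra meet only in zero. -/
theorem functional_nilMul_eq_zero (η : Labelling J F)
    (hη : ¬ ∃ i j k l : Fin n, J.IsFourChain i j k l ∧ (i, k) ∈ supp η ∧ (j, l) ∈ supp η)
    {A C : nilAlgebra J F}
    (h : ∀ B, functional η (nilMul B A) = functional η (nilMul C B)) (B : nilAlgebra J F) :
    functional η (nilMul B A) = 0 := by
  -- On each matrix unit one of the two equal functionals vanishes, hence both do.
  have : functional η ∘ₗ nilMul.flip A = 0 := dual_ext fun α => by
    rcases nilSingle_annihilates η hη α with h1 | h1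
    · exact h1 A
    · exact (h _).trans (h1 C)
  exact LinearMap.congr_fun this B

end

/-! ### Additive characters and linear duality -/

theorem addChar_eq_zero_of_forall_smul {F : Type*} [Field F] {θ : AddChar F ℂ} (hθ : θ ≠ 1) {a : F}
    (h : ∀ t : F, θ (t * a) = 1) : a = 0 := by
  by_contra ha
  refine hθ (DFunLike.ext _ _ fun x => ?_)
  rw [AddChar.one_apply, ← h (x * a⁻¹), inv_mul_cancel_right₀ ha]

/-- A functional that vanishes on the common kernel of a finite family lies in its span; finiteness
of `E` makes the family finite. -/
theorem exists_eq_add_of_ker_le {K E : Type*} [Field K] [AddCommGroup E] [Module K E] [Finite E]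
    (β γ : E →ₗ[K] Module.Dual K E) (f : Module.Dual K E)
    (h : ∀ b, (∀ x, β x b = 0) → (∀ x, γ x b = 0) → f b = 0) :
    ∃ y z, f = β y + γ z := by
  have h1 : f ∈ Submodule.span K (Set.range (Sum.elim β γ)) := by
    refine mem_span_of_iInf_ker_le_ker fun b hb => ?_
    rw [Submodule.mem_iInf] at hb
    exact h b (fun x => hb (Sum.inl x)) fun x => hb (Sum.inr x)
  have h2 : Submodule.span K (Set.range (Sum.elim β γ)) ≤
      LinearMap.range β ⊔ LinearMap.range γ := by
    rw [Submodule.span_le]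
    rintro _ ⟨x | x, rfl⟩
    · exact Submodule.mem_sup_left ⟨x, rfl⟩
    · exact Submodule.mem_sup_right ⟨x, rfl⟩
  obtain ⟨_, ⟨y, rfl⟩, _, ⟨z, rfl⟩, h3⟩ := Submodule.mem_sup.1 (h2 h1)
  exact ⟨y, z, h3.symm⟩

/-! ### The supercharacter as a monomial character -/

section

variable {n : ℕ} {J : ClosedPattern n} {F : Type*} [Field F] [Finite F]

theorem twoSidedMul_one_left (g : patternGroup J F) (X : nilAlgebra J F) :
    twoSidedMul 1 g X = X + nilMul X (subOne g) :=
  Subtype.ext (by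
    rw [Submodule.coe_add, coe_nilMul, coe_twoSidedMul, coe_subOne, toMatrix_one, one_mul,
      mul_sub, mul_one, add_sub_cancel])

theorem twoSidedMul_one_right (g : patternGroup J F) (X : nilAlgebra J F) :
    twoSidedMul g 1 X = X + nilMul (subOne g) X :=
  Subtype.ext (by
    rw [Submodule.coe_add, coe_nilMul, coe_twoSidedMul, coe_subOne, toMatrix_one, mul_one,
      sub_mul, one_mul, add_sub_cancel])

theorem subOne_mul (g h : patternGroup J F) :
    subOne (g * h) = twoSidedMul 1 h (subOne g) + subOne h :=
  Subtype.ext (by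
    rw [Submodule.coe_add, coe_twoSidedMul, coe_subOne, coe_subOne, coe_subOne, toMatrix_mul,
      toMatrix_one]
    noncomm_ring)

theorem subOne_one : subOne (1 : patternGroup J F) = 0 :=
  Subtype.ext (by rw [coe_subOne, toMatrix_one, sub_self, Submodule.coe_zero])

/-- The right translation action of the pattern group on the right orbit, as a left action. -/
instance rightCoorbitAction (η : Labelling J F) :
    MulAction (patternGroup J F) (rightCoorbit η) where
  smul g μ := ⟨coMul 1 μ.1 g⁻¹, by
    obtain ⟨_, v, rfl⟩ := μ
    exact ⟨v * g⁻¹, by rw [coMul_coMul, one_mul]⟩⟩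
  one_smul μ := Subtype.ext (by
    change coMul 1 μ.1 1⁻¹ = _
    rw [inv_one, coMul_one_one])
  mul_smul g h μ := Subtype.ext (by
    change coMul 1 μ.1 (g * h)⁻¹ = coMul 1 (coMul 1 μ.1 h⁻¹) g⁻¹
    rw [coMul_coMul, one_mul, mul_inv_rev])

theorem coe_smul_rightCoorbit (η : Labelling J F) (g : patternGroup J F) (μ : rightCoorbit η) :
    ((g • μ : rightCoorbit η) : Module.Dual F (nilAlgebra J F)) = coMul 1 μ.1 g⁻¹ := rfl

theorem smul_rightCoorbit_apply (η : Labelling J F) (g : patternGroup J F) (μ : rightCoorbit η)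
    (X : nilAlgebra J F) : (g • μ).1 X = μ.1 (twoSidedMul 1 g X) := by
  rw [coe_smul_rightCoorbit, coMul_apply, inv_one, inv_inv]

theorem functional_mem_rightCoorbit (η : Labelling J F) : functional η ∈ rightCoorbit η :=
  ⟨1, coMul_one_one _⟩

instance (η : Labelling J F) : MulAction.IsPretransitive (patternGroup J F) (rightCoorbit η) := by
  refine (MulAction.isPretransitive_iff_base (⟨functional η, functional_mem_rightCoorbit η⟩ : rightCoorbit η)).2 ?_
  rintro ⟨_, v, rfl⟩
  exact ⟨v⁻¹, Subtype.ext (by rw [coe_smul_rightCoorbit, inv_inv])⟩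

theorem smul_rightCoorbit_eq_iff {η : Labelling J F} {g : patternGroup J F} {μ : rightCoorbit η} :
    g • μ = μ ↔ ∀ X, μ.1 (nilMul X (subOne g)) = 0 := by
  rw [Subtype.ext_iff, LinearMap.ext_iff]
  refine forall_congr' fun X => ?_
  rw [smul_rightCoorbit_apply, twoSidedMul_one_left, map_add, add_eq_left]

variable (θ : AddChar F ℂ)

/-- The cocycle of the monomial representation that affords the supercharacter. -/
noncomputable def orbitCocycle (η : Labelling J F) (g : patternGroup J F) (μ : rightCoorbit η) :
    ℂ :=
  θ (-μ.1 (subOne g⁻¹))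

theorem orbitCocycle_one (η : Labelling J F) (μ : rightCoorbit η) : orbitCocycle θ η 1 μ = 1 := by
  rw [orbitCocycle, inv_one, subOne_one, map_zero, neg_zero, AddChar.map_zero_eq_one]

theorem orbitCocycle_mul (η : Labelling J F) (g h : patternGroup J F) (μ : rightCoorbit η) :
    orbitCocycle θ η (g * h) μ = orbitCocycle θ η g μ * orbitCocycle θ η h (g⁻¹ • μ) := by
  rw [orbitCocycle, orbitCocycle, orbitCocycle, smul_rightCoorbit_apply, ← AddChar.map_add_eq_mul,
    mul_inv_rev, subOne_mul, map_add, neg_add_rev]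

theorem exists_orbitCocycle_ne {θ : AddChar F ℂ} (hθ : θ ≠ 1) (η : Labelling J F)
    (hη : ¬ ∃ i j k l : Fin n, J.IsFourChain i j k l ∧ (i, k) ∈ supp η ∧ (j, l) ∈ supp η)
    (μ : rightCoorbit η) (hμ : μ ≠ ⟨functional η, functional_mem_rightCoorbit η⟩) :
    ∃ s : patternGroup J F, s • (⟨functional η, functional_mem_rightCoorbit η⟩ : rightCoorbit η) =
      ⟨functional η, functional_mem_rightCoorbit η⟩ ∧ s • μ = μ ∧
      orbitCocycle θ η s ⟨functional η, functional_mem_rightCoorbit η⟩ ≠ orbitCocycle θ η s μ := by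
  have : Finite (nilAlgebra J F) := Module.finite_of_finite F
  set o : rightCoorbit η := ⟨functional η, functional_mem_rightCoorbit η⟩ with ho
  contrapose! hμ
  obtain ⟨g, hg⟩ := MulAction.exists_smul_eq (patternGroup J F) o μ
  set A := subOne g with hA
  have hμA : ∀ X, μ.1 X = functional η X + functional η (nilMul X A) := fun X => by
    rw [← hg, smul_rightCoorbit_apply, twoSidedMul_one_left, map_add]
  have hvanish : ∀ B, (∀ X, functional η (nilMul X B) = 0) → (∀ X, μ.1 (nilMul X B) = 0) →
      θ (functional η (nilMul B A)) = 1 := by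
    intro B h1 h2
    have h3 : oneAdd B • o = o := smul_rightCoorbit_eq_iff.2 fun X => by
      rw [subOne_oneAdd]
      exact h1 X
    have h4 : oneAdd B • μ = μ := smul_rightCoorbit_eq_iff.2 fun X => by
      rw [subOne_oneAdd]
      exact h2 X
    -- The inverse is used because the cocycle at s evaluates at s⁻¹ - 1.
    have h5 := hμ (oneAdd B)⁻¹ (inv_smul_eq_iff.2 h3.symm) (inv_smul_eq_iff.2 h4.symm)
    rw [orbitCocycle, orbitCocycle, inv_inv, subOne_oneAdd, hμA] at h5
    have h6 : functional η (nilMul B A) = -functional η B +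
        -(-(functional η B + functional η (nilMul B A))) := by ring
    rw [h6, AddChar.map_add_eq_mul, AddChar.map_neg_eq_inv θ (-(_ + _)), ← h5]
    exact mul_inv_cancel₀ ((θ.val_isUnit _).ne_zero)
  obtain ⟨y, z, hyz⟩ := exists_eq_add_of_ker_le (K := F) (E := nilAlgebra J F)
    ((nilMul (J := J)).compr₂ (functional η)) ((nilMul (J := J)).compr₂ μ.1)
    -- The conditions on `B` are linear, so `hvanish` holds for every multiple of `B`, and
    -- nontriviality of `θ` upgrades θ(λ(BA)) = 1 to λ(BA) = 0.
    (functional η ∘ₗ nilMul.flip A) (fun B h1 h2 => addChar_eq_zero_of_forall_smul hθ fun t => by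
      have := hvanish (t • B)
        (fun X => by rw [map_smul, map_smul, show functional η (nilMul X B) = 0 from h1 X,
          smul_zero])
        (fun X => by rw [map_smul, map_smul, show μ.1 (nilMul X B) = 0 from h2 X, smul_zero])
      rwa [map_smul, LinearMap.smul_apply, map_smul] at this)
  have hyz' : ∀ B, functional η (nilMul B A) = functional η (nilMul y B) +
      (functional η (nilMul z B) + functional η (nilMul (nilMul z B) A)) := fun B => by
    rw [← hμA]
    exact LinearMap.congr_fun hyz B
  -- `hyz'` reads λ((1 - z)BA) = λ((y + z)B); substituting (1 - z)⁻¹B for B puts it in the form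
  -- λ(BA) = λ(CB).
  set u := oneAdd (-z) with hu
  have hswap : ∀ B, functional η (nilMul B A) =
      functional η (nilMul (twoSidedMul 1 u⁻¹ (y + z)) B) := by
    intro B
    set B' := twoSidedMul u⁻¹ 1 B with hB'
    have hB : B = B' - nilMul z B' := by
      have h1 : B = twoSidedMul u 1 B' := by
        rw [hB', twoSidedMul_twoSidedMul, mul_inv_cancel, one_mul, twoSidedMul_one_one]
      conv_lhs => rw [h1, twoSidedMul_one_right, hu, subOne_oneAdd]
      rw [map_neg, LinearMap.neg_apply, sub_eq_add_neg]
    have hC : nilMul (twoSidedMul 1 u⁻¹ (y + z)) B = nilMul (y + z) B' :=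
      Subtype.ext (by
        simp only [coe_nilMul, hB', coe_twoSidedMul, toMatrix_one, one_mul, mul_one, mul_assoc])
    rw [hC]
    conv_lhs => rw [hB]
    rw [map_sub, LinearMap.sub_apply, map_sub, hyz' B', map_add, LinearMap.add_apply, map_add]
    ring
  apply Subtype.ext
  apply LinearMap.ext
  intro X
  rw [hμA, functional_nilMul_eq_zero η hη hswap, add_zero]

/-- As u runs over 1 + 𝔫_J, this is a sum of an additive character of 𝔫_J, which vanishes unless
that character is trivial, that is, unless `g` fixes `μ` on the right. -/
theorem sum_addChar_twoSidedMul {θ : AddChar F ℂ} (hθ : θ ≠ 1) [Fintype (patternGroup J F)]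
    (μ : Module.Dual F (nilAlgebra J F)) (g : patternGroup J F)
    [Decidable (∀ X, μ (nilMul X (subOne g)) = 0)] :
    ∑ u : patternGroup J F, θ (μ (twoSidedMul u 1 (subOne g))) =
      Fintype.card (patternGroup J F) *
        if ∀ X, μ (nilMul X (subOne g)) = 0 then θ (μ (subOne g)) else 0 := by
  simp only [twoSidedMul_one_right, map_add, AddChar.map_add_eq_mul]
  rw [← Finset.mul_sum]
  split_ifs with h
  · simp [h, mul_comm]
  · rw [mul_zero]
    apply mul_eq_zero_of_right
    have : Finite (nilAlgebra J F) := Module.finite_of_finite F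
    have := Fintype.ofFinite (nilAlgebra J F)
    let e : patternGroup J F ≃ nilAlgebra J F :=
      ⟨subOne, oneAdd, oneAdd_subOne, subOne_oneAdd⟩
    let ψ : AddChar (nilAlgebra J F) ℂ :=
      θ.compAddMonoidHom (μ ∘ₗ nilMul.flip (subOne g)).toAddMonoidHom
    refine (Equiv.sum_comp e ψ).trans (AddChar.sum_eq_zero_iff_ne_zero.2 fun h0 => h fun X => ?_)
    refine addChar_eq_zero_of_forall_smul hθ fun t => ?_
    have h1 : ψ (t • X) = 1 := by rw [h0, AddChar.zero_apply]
    have h2 : ψ (t • X) = θ (μ (nilMul (t • X) (subOne g))) := rfl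
    rwa [h2, map_smul, LinearMap.smul_apply, map_smul] at h1

theorem supercharacter_eq {θ : AddChar F ℂ} (hθ : θ ≠ 1) (η : Labelling J F)
    [Fintype (rightCoorbit η)] [DecidableEq (rightCoorbit η)] (g : patternGroup J F) :
    supercharacter θ η g =
      ∑ μ : rightCoorbit η, if g⁻¹ • μ = μ then orbitCocycle θ η g μ else 0 := by
  classical
  have := Fintype.ofFinite (patternGroup J F)
  set f : Module.Dual F (nilAlgebra J F) → ℂ := fun μ =>
    if ∀ X, μ (nilMul X (subOne g)) = 0 then θ (μ (subOne g)) else 0 with hf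
  have hright : ∀ μ : rightCoorbit η,
      (if g⁻¹ • μ = μ then orbitCocycle θ η g μ else 0) = f μ.1 := by
    intro μ
    have hiff : g⁻¹ • μ = μ ↔ ∀ X, μ.1 (nilMul X (subOne g)) = 0 := by
      rw [inv_smul_eq_iff, eq_comm, smul_rightCoorbit_eq_iff]
    rw [hf]
    refine ite_congr (propext hiff) (fun h => ?_) fun _ => rfl
    -- On its stabilizer `μ` is additive in u - 1, so the cocycle value is θ(μ(g - 1)).
    have h1 : μ.1 (subOne g) + μ.1 (subOne g⁻¹) = 0 := by
      have h2 : μ.1 (subOne (g⁻¹ * g)) = 0 := by rw [inv_mul_cancel, subOne_one, map_zero]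
      rw [subOne_mul, twoSidedMul_one_left, map_add, map_add, h, add_zero] at h2
      rwa [add_comm]
    rw [orbitCocycle, ← eq_neg_of_add_eq_zero_left h1]
  rw [Finset.sum_congr rfl fun μ _ => hright μ]
  have hcardR : (rightCoorbit η).ncard = (rightCoorbit η).toFinset.card :=
    Set.ncard_eq_toFinset_card' _
  have hsumR : ∑ μ : rightCoorbit η, f μ.1 = ∑ μ ∈ (rightCoorbit η).toFinset, f μ :=
    (Finset.sum_subtype _ (fun _ => Set.mem_toFinset) f).symm
  have hR := card_mul_sum_comp (H := patternGroup J F) (fun v => coMul 1 (functional η) v⁻¹)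
    (fun a b c h => by
      have := congrArg (fun μ => coMul 1 μ c⁻¹) h
      simpa only [coMul_coMul, one_mul, ← mul_inv_rev] using this)
    (rightCoorbit η).toFinset (by
      rw [Set.coe_toFinset]
      exact ((Equiv.inv (patternGroup J F)).surjective.range_comp _).symm) f
  have hL := card_mul_sum_comp (H := patternGroup J F × patternGroup J F)
    (fun p => coMul p.1 (functional η) p.2⁻¹)
    (fun a b c h => by
      have := congrArg (fun μ => coMul c.1 μ c.2⁻¹) h
      simpa only [coMul_coMul, ← mul_inv_rev, Prod.fst_mul, Prod.snd_mul] using this)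
    (finite_twoSidedCoorbit η).toFinset (by
      rw [Set.Finite.coe_toFinset]
      exact (((Equiv.refl (patternGroup J F)).prodCongr
        (Equiv.inv (patternGroup J F))).surjective.range_comp _).symm)
    fun μ => θ (μ (subOne g))
  -- Summing over the left factor keeps only the right translates fixed by `g`.
  have hdouble : ∑ p : patternGroup J F × patternGroup J F,
      θ (coMul p.1 (functional η) p.2⁻¹ (subOne g)) =
      Fintype.card (patternGroup J F) *
        ∑ v : patternGroup J F, f (coMul 1 (functional η) v⁻¹) := by
    rw [Fintype.sum_prod_type_right, Finset.mul_sum]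
    refine Finset.sum_congr rfl fun v _ => ?_
    rw [hf, ← sum_addChar_twoSidedMul hθ, ← Equiv.sum_comp (Equiv.inv (patternGroup J F))]
    refine Finset.sum_congr rfl fun u _ => ?_
    simp only [coMul_apply, twoSidedMul_twoSidedMul, Equiv.inv_apply, inv_inv, inv_one, one_mul]
  have hG : (Fintype.card (patternGroup J F) : ℂ) ≠ 0 := Nat.cast_ne_zero.2 Fintype.card_ne_zero
  have hO : ((finite_twoSidedCoorbit η).toFinset.card : ℂ) ≠ 0 := by
    refine Nat.cast_ne_zero.2 (Finset.card_ne_zero_of_mem (a := functional η) ?_)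
    rw [Set.Finite.mem_toFinset]
    exact ⟨(1, 1), coMul_one_one _⟩
  rw [supercharacter, hcardR, Set.ncard_eq_toFinset_card _ (finite_twoSidedCoorbit η), hsumR]
  rw [hdouble, Fintype.card_prod] at hL
  push_cast at hL
  rw [div_mul_eq_mul_div, div_eq_iff hO]
  apply mul_left_cancel₀ (mul_ne_zero hG hG)
  linear_combination (-((rightCoorbit η).toFinset.card : ℂ)) * hL +
    (Fintype.card (patternGroup J F) : ℂ) *
      ((finite_twoSidedCoorbit η).toFinset.card : ℂ) * hR

theorem isIrreducibleCharacter_supercharacter {θ : AddChar F ℂ} (hθ : θ ≠ 1) (η : Labelling J F)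
    (hη : ¬ ∃ i j k l : Fin n, J.IsFourChain i j k l ∧ (i, k) ∈ supp η ∧ (j, l) ∈ supp η) :
    IsIrreducibleCharacter (supercharacter θ η) := by
  classical
  have : Finite (rightCoorbit η) := (Set.finite_range _).to_subtype
  have := Fintype.ofFinite (rightCoorbit η)
  rw [show supercharacter θ η = _ from funext fun g => supercharacter_eq hθ η g]
  exact isIrreducibleCharacter_monomial (orbitCocycle θ η) (orbitCocycle_one θ η)
    (orbitCocycle_mul θ η) ⟨functional η, functional_mem_rightCoorbit η⟩
    (exists_orbitCocycle_ne hθ η hη)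

end

end PatternGroups

theorem mainTheorem3 {n : ℕ} (J : PatternGroups.ClosedPattern n)
    {F : Type*} [Field F] [Finite F] (θ : AddChar F ℂ) (hθ : θ ≠ 1) :
    (∀ φ : PatternGroups.Labelling J F,
      (¬ ∃ i j k l : Fin n, J.IsFourChain i j k l ∧
        (i, j) ∈ PatternGroups.supp φ ∧ (k, l) ∈ PatternGroups.supp φ) →
      PatternGroups.superclass φ = conjugatesOf (PatternGroups.groupElement φ)) ∧
    (∀ η : PatternGroups.Labelling J F,
      (¬ ∃ i j k l : Fin n, J.IsFourChain i j k l ∧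
        (i, k) ∈ PatternGroups.supp η ∧ (j, l) ∈ PatternGroups.supp η) →
      PatternGroups.IsIrreducibleCharacter (PatternGroups.supercharacter θ η)) := by
  exact ⟨fun φ hφ => PatternGroups.superclass_eq_conjugatesOf φ hφ,
    fun η hη => PatternGroups.isIrreducibleCharacter_supercharacter hθ η hη⟩
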